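/- Let $\vartheta:\mathbb{R}^n\to\mathbb{R}\cup\{\infty\}$ be closed (closed epigraph), proper and convex with $\operatorname{int}(\operatorname{dom}\vartheta)\neq\varnothing$, where $\operatorname{dom}\vartheta=\{x:\vartheta(x)<\infty\}$, and suppose that $\vartheta$ is Legendre, that is, - essentially smooth: $\vartheta$ is differentiable on $\operatorname{int}(\operatorname{dom}\vartheta)$, and $\|\nabla\vartheta(x_k)\|\to\infty$ whenever $(x_k)$ is a sequence in $\operatorname{int}(\operatorname{dom}\vartheta)$ converging to a boundary point of $\operatorname{dom}\vartheta$; and - essentially strictly convex: $\vartheta$ is strictly convex on every convex subset of $\operatorname{dom}(\partial\vartheta)=\{x:\partial\vartheta(x)\neq\varnothing\}$. Let $\epsilon>0$, $\psi=\epsilon\vartheta$, let $\psi^\star(z)=\sup_{x\in\mathbb{R}^n}[x^\top z-\psi(x)]$ be the convex conjugate of $\psi$, and let $C(z)=\operatorname{argmax}_{y\in\operatorname{dom}\psi}[y^\top z-\psi(y)]$ be the mirror map induced by $\psi$. Then: (i) $\psi^\star$ is closed, proper and Legendre (in particular convex, with $\operatorname{int}(\operatorname{dom}\psi^\star)\neq\varnothing$).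 If moreover the maximum defining $C(z)$ is attained for every $z\in\mathbb{R}^n$, or if $\vartheta$ is supercoercive ($\vartheta(x)/\|x\|\to\infty$ as $\|x\|\to\infty$), then $\psi^\star$ is finite-valued on $\mathbb{R}^n$, i.e. $\operatorname{dom}\psi^\star=\mathbb{R}^n$. (ii) $\nabla\psi:\operatorname{int}(\operatorname{dom}\psi)\to\operatorname{int}(\operatorname{dom}\psi^\star)$ is a homeomorphism with inverse $(\nabla\psi)^{-1}=\nabla\psi^\star$. For every $z\in\operatorname{int}(\operatorname{dom}\psi^\star)$ the maximizer defining $C(z)$ exists and is unique, and $\nabla\psi^\star(z)=C(z)$. (iii) $C$ is strictly monotone on $\operatorname{int}(\operatorname{dom}\psi^\star)$: $(C(z)-C(z'))^\top(z-z')>0$ for all $z\neq z'$ in $\operatorname{int}(\operatorname{dom}\psi^\star)$. -/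

import Mathlib

open Set Filter Topology

noncomputable section

namespace ConvexDuality

variable {n : ℕ}

/-- The effective domain of an extended real-valued function. -/
def effDom (f : EuclideanSpace ℝ (Fin n) → EReal) : Set (EuclideanSpace ℝ (Fin n)) :=
  {x | f x < ⊤}

/-- The epigraph, as a subset of `ℝⁿ × ℝ`. -/
def epigraph (f : EuclideanSpace ℝ (Fin n) → EReal) : Set (EuclideanSpace ℝ (Fin n) × ℝ) :=
  {p | f p.1 ≤ (p.2 : EReal)}

/-- `f` is proper: it never takes the value `-∞`, and it is not identically `+∞`. -/
def IsProperFun (f : EuclideanSpace ℝ (Fin n) → EReal) : Prop :=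
  (∀ x, f x ≠ ⊥) ∧ ∃ x, f x < ⊤

/-- `f` is closed: its epigraph is closed. -/
def IsClosedFun (f : EuclideanSpace ℝ (Fin n) → EReal) : Prop :=
  IsClosed (epigraph f)

/-- `f` is convex: its epigraph is convex. -/
def IsConvexFun (f : EuclideanSpace ℝ (Fin n) → EReal) : Prop :=
  Convex ℝ (epigraph f)

/-- `f` is supercoercive: `f x / ‖x‖ → +∞` as `‖x‖ → ∞`. -/
def IsSupercoercive (f : EuclideanSpace ℝ (Fin n) → EReal) : Prop :=
  Tendsto (fun x => f x / ((‖x‖ : ℝ) : EReal))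
    (Bornology.cobounded (EuclideanSpace ℝ (Fin n))) (𝓝 ⊤)

/-- The gradient of an extended real-valued function. It is used only at interior points of the
effective domain of proper functions; near such a point `f` and `fun y => (f y).toReal` agree. -/
def grad (f : EuclideanSpace ℝ (Fin n) → EReal) (x : EuclideanSpace ℝ (Fin n)) :
    EuclideanSpace ℝ (Fin n) :=
  gradient (fun y => (f y).toReal) x

/-- The subdifferential `∂f(x)`. -/
def subdiff (f : EuclideanSpace ℝ (Fin n) → EReal) (x : EuclideanSpace ℝ (Fin n)) :
    Set (EuclideanSpace ℝ (Fin n)) :=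
  {v | ∀ y, f x + ((inner ℝ v (y - x) : ℝ) : EReal) ≤ f y}

/-- The domain of the subdifferential: the points where it is nonempty. -/
def domSubdiff (f : EuclideanSpace ℝ (Fin n) → EReal) : Set (EuclideanSpace ℝ (Fin n)) :=
  {x | (subdiff f x).Nonempty}

/-- Essential smoothness: `int (dom f)` is nonempty, `f` is differentiable there, and the norm of
the gradient tends to infinity along every sequence in `int (dom f)` that converges to a boundary
point of `dom f`. -/
structure IsEssentiallySmooth (f : EuclideanSpace ℝ (Fin n) → EReal) : Prop where
  interior_nonempty : (interior (effDom f)).Nonempty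
  differentiableAt : ∀ x ∈ interior (effDom f), DifferentiableAt ℝ (fun y => (f y).toReal) x
  steep : ∀ (x : ℕ → EuclideanSpace ℝ (Fin n)) (b : EuclideanSpace ℝ (Fin n)),
    (∀ k, x k ∈ interior (effDom f)) → b ∈ frontier (effDom f) → Tendsto x atTop (𝓝 b) →
      Tendsto (fun k => ‖grad f (x k)‖) atTop atTop

/-- Essential strict convexity: `f` is strictly convex on every convex subset of `dom ∂f`
(a proper function is finite on `dom ∂f`). -/
def IsEssentiallyStrictlyConvex (f : EuclideanSpace ℝ (Fin n) → EReal) : Prop :=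
  ∀ S : Set (EuclideanSpace ℝ (Fin n)), S ⊆ domSubdiff f → Convex ℝ S →
    StrictConvexOn ℝ S (fun y => (f y).toReal)

/-- A closed proper convex function with `int (dom f) ≠ ∅` is Legendre if it is essentially smooth
and essentially strictly convex. -/
structure IsLegendre (f : EuclideanSpace ℝ (Fin n) → EReal) : Prop where
  isClosedFun : IsClosedFun f
  isProperFun : IsProperFun f
  isConvexFun : IsConvexFun f
  essentiallySmooth : IsEssentiallySmooth f
  essentiallyStrictlyConvex : IsEssentiallyStrictlyConvex f

/-- The convex conjugate `f⋆(z) = sup_x (⟨x, z⟩ - f x)`. -/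
def conjugate (f : EuclideanSpace ℝ (Fin n) → EReal) (z : EuclideanSpace ℝ (Fin n)) : EReal :=
  ⨆ x : EuclideanSpace ℝ (Fin n), (((inner ℝ x z : ℝ) : EReal) - f x)

/-- The set of maximizers of `y ↦ ⟨y, z⟩ - f y` over `dom f`. -/
def mirrorArgmax (f : EuclideanSpace ℝ (Fin n) → EReal) (z : EuclideanSpace ℝ (Fin n)) :
    Set (EuclideanSpace ℝ (Fin n)) :=
  {x | x ∈ effDom f ∧ ∀ y ∈ effDom f,
    ((inner ℝ y z : ℝ) : EReal) - f y ≤ ((inner ℝ x z : ℝ) : EReal) - f x}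

/-- The mirror map induced by `f`: `z ↦ argmax_{y ∈ dom f} (⟨y, z⟩ - f y)`. It picks an element of
`mirrorArgmax f z` whenever there is one. -/
def mirrorMap (f : EuclideanSpace ℝ (Fin n) → EReal) (z : EuclideanSpace ℝ (Fin n)) :
    EuclideanSpace ℝ (Fin n) :=
  Classical.epsilon (fun x => x ∈ mirrorArgmax f z)

/-- Strict monotonicity of a map on a set. -/
def StrictlyMonotoneOn (F : EuclideanSpace ℝ (Fin n) → EuclideanSpace ℝ (Fin n))
    (S : Set (EuclideanSpace ℝ (Fin n))) : Prop :=
  ∀ z ∈ S, ∀ w ∈ S, z ≠ w → 0 < (inner ℝ (F z - F w) (z - w) : ℝ)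

end ConvexDuality

end

open ConvexDuality

/-!
Essential smoothness makes the subdifferential of a Legendre function `f` single-valued: it is
`{∇f}` on `int (dom f)` and empty elsewhere. At `x` in `int (dom f)` the tilted function
`f - ⟨∇f(x), ·⟩` has a strict minimum on a small ball; the minimum stays in the interior of the ball
under small changes of the slope, so `∇f` is open. As `z ∈ ∂f(x)` implies `x ∈ ∂f⋆(z)`, the inverse
of `∇f` is `∇f⋆`.

For `z` in `int (dom f⋆)` the function `⟨·, z⟩ - f` tends to `-∞` at infinity, hence attains its
maximum, at a point `x` with `z = ∇f(x)`; thus `∇f` is onto `int (dom f⋆)`. Finally `f⋆` is steep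
because `∂f` has a closed graph, and strictly convex because `∂f` is single-valued.
-/

namespace ConvexDuality

open scoped InnerProductSpace

section Subgradient

variable {E : Type*} [NormedAddCommGroup E] [InnerProductSpace ℝ E]
  {D S : Set E} {F : E → ℝ} {x y v w : E} {r M t : ℝ}

/-- `v` is a subgradient at `x` of the real-valued function `F` with domain `D`: the affine minorant
of slope `v` through `(x, F x)` stays below `F` on `D`. The point `x` itself need not lie in `D`. -/
def IsSubgradientOn (F : E → ℝ) (D : Set E) (x v : E) : Prop :=
  ∀ y ∈ D, F x + ⟪v, y - x⟫_ℝ ≤ F y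

theorem IsSubgradientOn.inner_sub_nonneg (hv : IsSubgradientOn F D x v)
    (hw : IsSubgradientOn F D y w) (hx : x ∈ D) (hy : y ∈ D) : 0 ≤ ⟪w - v, y - x⟫_ℝ := by
  have hxy := hv y hy
  have hyx := hw x hx
  rw [← neg_sub y x, inner_neg_right] at hyx
  rw [inner_sub_left]
  linarith

theorem isSubgradientOn_iff_isMinOn :
    IsSubgradientOn F D x v ↔ IsMinOn (fun y => F y - ⟪v, y⟫_ℝ) D x := by
  refine forall₂_congr fun y _ => ?_
  simp only [mem_ofPred_eq, inner_sub_right]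
  constructor <;> intro h <;> linarith

theorem isSubgradientOn_gradient [CompleteSpace E] (hF : ConvexOn ℝ D F) (hx : x ∈ D)
    (hd : DifferentiableAt ℝ F x) : IsSubgradientOn F D x (gradient F x) := by
  intro y hy
  have hline : HasDerivAt (fun t : ℝ => F (AffineMap.lineMap x y t)) ⟪gradient F x, y - x⟫_ℝ 0 := by
    rw [inner_gradient_left]
    refine HasFDerivAt.comp_hasDerivAt_of_eq (0 : ℝ) hd.hasFDerivAt
      AffineMap.hasDerivAt_lineMap (by simp)
  have hslope := (hF.comp_affineMap (AffineMap.lineMap x y)).le_slope_of_hasDerivAt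
    (by simpa using hx) (by simpa using hy) zero_lt_one hline
  simp only [slope_def_field, Function.comp_apply, AffineMap.lineMap_apply_zero,
    AffineMap.lineMap_apply_one, sub_zero, div_one] at hslope
  linarith

theorem IsSubgradientOn.eq_gradient [CompleteSpace E] (hv : IsSubgradientOn F D x v)
    (hD : D ∈ 𝓝 x) (hd : DifferentiableAt ℝ F x) : v = gradient F x := by
  have hmin := (isSubgradientOn_iff_isMinOn.1 hv).isLocalMin hD
  have hzero := hmin.hasFDerivAt_eq_zero (hd.hasFDerivAt.sub (innerSL ℝ v).hasFDerivAt)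
  refine ext_inner_right ℝ fun w => ?_
  rw [inner_gradient_left, sub_eq_zero.1 hzero, innerSL_apply_apply]

theorem IsSubgradientOn.add_inner_lt (hv : IsSubgradientOn F S x v) (hF : StrictConvexOn ℝ S F)
    (hx : x ∈ S) (hy : y ∈ S) (hne : y ≠ x) : F x + ⟪v, y - x⟫_ℝ < F y := by
  have hhalf : (0 : ℝ) < 1 / 2 := by norm_num
  have hlt := hF.2 hx hy hne.symm hhalf hhalf (by norm_num)
  have hle := hv _ (hF.1 hx hy hhalf.le hhalf.le (by norm_num))
  have hmid : (1 / 2 : ℝ) • x + (1 / 2 : ℝ) • y - x = (1 / 2 : ℝ) • (y - x) := by module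
  rw [hmid, inner_smul_right] at hle
  simp only [smul_eq_mul] at hlt
  linarith

theorem IsSubgradientOn.inner_sub_pos (hv : IsSubgradientOn F S x v)
    (hw : IsSubgradientOn F S y w) (hF : StrictConvexOn ℝ S F) (hx : x ∈ S) (hy : y ∈ S)
    (hne : x ≠ y) : 0 < ⟪v - w, x - y⟫_ℝ := by
  have hxy := hv.add_inner_lt hF hx hy hne.symm
  have hyx := hw.add_inner_lt hF hy hx hne
  rw [← neg_sub x y, inner_neg_right] at hxy
  rw [inner_sub_left]
  linarith

theorem strictConvexOn_of_forall_exists_add_inner_lt (hS : Convex ℝ S)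
    (h : ∀ x ∈ S, ∃ v, ∀ y ∈ S, y ≠ x → F x + ⟪v, y - x⟫_ℝ < F y) : StrictConvexOn ℝ S F := by
  refine ⟨hS, fun x hx y hy hne a b ha hb hab => ?_⟩
  obtain rfl : a = 1 - b := by linarith
  obtain ⟨v, hv⟩ := h _ (hS hx hy ha.le hb.le hab)
  set m := (1 - b) • x + b • y with hm
  have hxm : x - m = (-b) • (y - x) := by rw [hm]; module
  have hym : y - m = (1 - b) • (y - x) := by rw [hm]; module
  have hyx : y - x ≠ 0 := sub_ne_zero.2 hne.symm
  have hltx := hv x hx (sub_ne_zero.1 (hxm ▸ smul_ne_zero (neg_ne_zero.2 hb.ne') hyx))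
  have hlty := hv y hy (sub_ne_zero.1 (hym ▸ smul_ne_zero ha.ne' hyx))
  rw [hxm, inner_smul_right] at hltx
  rw [hym, inner_smul_right] at hlty
  simp only [smul_eq_mul]
  linarith [mul_lt_mul_of_pos_left hltx ha, mul_lt_mul_of_pos_left hlty hb]

theorem exists_norm_le_inner_eq_mul_norm (g : E) (hr : 0 ≤ r) :
    ∃ w : E, ‖w‖ ≤ r ∧ ⟪g, w⟫_ℝ = r * ‖g‖ := by
  rcases eq_or_ne g 0 with rfl | hg
  · exact ⟨0, by simpa using hr, by simp⟩
  · have hpos : 0 < ‖g‖ := norm_pos_iff.2 hg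
    refine ⟨(r / ‖g‖) • g, ?_, ?_⟩
    · rw [norm_smul, Real.norm_of_nonneg (by positivity), div_mul_cancel₀ _ hpos.ne']
    · rw [inner_smul_right, real_inner_self_eq_norm_sq]
      field_simp

theorem IsSubgradientOn.mul_norm_le {g : E} (hv : IsSubgradientOn F D x v)
    (hg : IsSubgradientOn F D (x + t • (y - x)) g) (hx : x ∈ D) (hp : x + t • (y - x) ∈ D)
    (ht : 0 < t) (ht' : t ≤ 1) (hr : 0 ≤ r) (hball : ∀ u ∈ Metric.closedBall y r, u ∈ D ∧ F u ≤ M) :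
    r * ‖g‖ ≤ M - F x - ⟪v, y - x⟫_ℝ := by
  have hmono : ⟪v, y - x⟫_ℝ ≤ ⟪g, y - x⟫_ℝ := by
    have h := hv.inner_sub_nonneg hg hx hp
    rw [add_sub_cancel_left, inner_smul_right, inner_sub_left] at h
    linarith [nonneg_of_mul_nonneg_right h ht]
  obtain ⟨w, hwr, hgw⟩ := exists_norm_le_inner_eq_mul_norm g hr
  obtain ⟨hwD, hwM⟩ := hball (y + w) (by simpa using hwr)
  have hleft := hv _ hp
  have hright := hg _ hwD
  have hsub : y + w - (x + t • (y - x)) = (1 - t) • (y - x) + w := by module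
  rw [hsub, inner_add_right, inner_smul_right, hgw] at hright
  rw [add_sub_cancel_left, inner_smul_right] at hleft
  linarith [mul_le_mul_of_nonneg_left hmono (sub_nonneg.2 ht')]

theorem exists_forall_mem_closedBall_le [FiniteDimensional ℝ E] (hF : ConvexOn ℝ D F)
    (hx : x ∈ interior D) : ∃ r > 0, ∃ M, ∀ u ∈ Metric.closedBall x r, u ∈ D ∧ F u ≤ M := by
  have hcont : ContinuousAt F x :=
    hF.continuousOn_interior.continuousAt (isOpen_interior.mem_nhds hx)
  obtain ⟨r, hr, h⟩ := Metric.nhds_basis_closedBall.eventually_iff.1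
    (Filter.Eventually.and (mem_interior_iff_mem_nhds.1 hx)
      (hcont.eventually_le_const (lt_add_one (F x))))
  exact ⟨r, hr, F x + 1, fun _ hu => h hu⟩

theorem IsSubgradientOn.hasGradientAt [CompleteSpace E] (hv : IsSubgradientOn F D x v)
    (hx : x ∈ D)
    (hnear : ∀ c > 0, ∀ᶠ y in 𝓝 x, y ∈ D ∧ ∃ w ∈ Metric.ball v c, IsSubgradientOn F D y w) :
    HasGradientAt F v x := by
  rw [hasGradientAt_iff_isLittleO, Asymptotics.isLittleO_iff]
  intro c hc
  filter_upwards [hnear c hc] with y ⟨hy, w, hwv, hw⟩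
  have hlower := hv y hy
  have hupper := hw x hx
  have hcs : ⟪w - v, y - x⟫_ℝ ≤ c * ‖y - x‖ := (real_inner_le_norm _ _).trans
    (mul_le_mul_of_nonneg_right (mem_ball_iff_norm.1 hwv).le (norm_nonneg _))
  rw [← neg_sub y x, inner_neg_right] at hupper
  rw [inner_sub_left] at hcs
  rw [Real.norm_of_nonneg (by linarith)]
  linarith

theorem eventually_exists_mem_ball_isSubgradientOn [FiniteDimensional ℝ E] (hF : ConvexOn ℝ D F)
    (hr : 0 < r) (hball : Metric.closedBall x r ⊆ interior D)
    (hlt : ∀ y ∈ Metric.sphere x r, F x + ⟪v, y - x⟫_ℝ < F y) :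
    ∀ᶠ w in 𝓝 v, ∃ y ∈ Metric.ball x r, IsSubgradientOn F D y w := by
  have hcont := hF.continuousOn_interior
  have hsphere : ∀ᶠ w in 𝓝 v, ∀ y ∈ Metric.sphere x r, F x + ⟪w, y - x⟫_ℝ < F y := by
    refine (isCompact_sphere x r).eventually_forall_of_forall_eventually fun y hy => ?_
    have hFy : ContinuousAt F y := hcont.continuousAt
      (isOpen_interior.mem_nhds (hball (Metric.sphere_subset_closedBall hy)))
    exact ContinuousAt.eventually_lt (by fun_prop) (hFy.comp continuousAt_snd) (hlt y hy)
  filter_upwards [hsphere] with w hw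
  obtain ⟨y, hy, hmin⟩ := (isCompact_closedBall x r).exists_isMinOn
    ⟨x, Metric.mem_closedBall_self hr.le⟩
    (f := fun u => F u - ⟪w, u⟫_ℝ) ((hcont.mono hball).sub (by fun_prop))
  have hyball : y ∈ Metric.ball x r := by
    refine (Metric.mem_closedBall.1 hy).lt_of_ne fun hyr => ?_
    have hle : F y - ⟪w, y⟫_ℝ ≤ F x - ⟪w, x⟫_ℝ := hmin (Metric.mem_closedBall_self hr.le)
    have hlt := hw y hyr
    rw [inner_sub_right] at hlt
    linarith
  refine ⟨y, hyball, isSubgradientOn_iff_isMinOn.2 ?_⟩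
  refine IsMinOn.of_isLocalMinOn_of_convexOn (interior_subset (hball hy)) ?_
    (hF.sub ((innerₗ E w).concaveOn hF.1))
  exact (hmin.isLocalMin (mem_of_superset (Metric.isOpen_ball.mem_nhds hyball)
    Metric.ball_subset_closedBall)).on D

end Subgradient

section Topology

theorem exists_forall_ge_of_tendsto_cocompact {X β : Type*} [TopologicalSpace X] [Nonempty X]
    [LinearOrder β] [OrderBot β] [TopologicalSpace β] [OrderTopology β] {f : X → β}
    (hf : UpperSemicontinuous f) (hlim : Tendsto f (cocompact X) (𝓝 ⊥)) : ∃ x, ∀ y, f y ≤ f x := by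
  by_cases hbot : ∀ x, f x = ⊥
  · exact ⟨Classical.arbitrary X, fun y => by simp only [hbot, le_refl]⟩
  push Not at hbot
  obtain ⟨x₀, hx₀⟩ := hbot
  obtain ⟨K, hK, hKlt⟩ := hasBasis_cocompact.eventually_iff.1
    (hlim.eventually_lt_const (bot_lt_iff_ne_bot.2 hx₀))
  have hx₀K : x₀ ∈ K := by
    by_contra h
    exact (hKlt h).false
  obtain ⟨x, -, hmax⟩ := (hf.upperSemicontinuousOn K).exists_isMaxOn ⟨x₀, hx₀K⟩ hK
  refine ⟨x, fun y => ?_⟩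
  by_cases hy : y ∈ K
  · exact hmax hy
  · exact (hKlt hy).le.trans (hmax hx₀K)

theorem continuousAt_of_nhds_le_map {X Y : Type*} [TopologicalSpace X] [TopologicalSpace Y]
    {g : X → Y} {h : Y → X} {y : Y} (hh : 𝓝 (h y) ≤ map h (𝓝 y))
    (hgh : ∀ᶠ u in 𝓝 y, g (h u) = u) : ContinuousAt g (h y) := by
  rw [ContinuousAt, hgh.self_of_nhds]
  exact Tendsto.mono_left (tendsto_map'_iff.2 (tendsto_id.congr' (hgh.mono fun _ hu => hu.symm)))
    hh

end Topology

section ExtendedReal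

variable {n : ℕ} {f : EuclideanSpace ℝ (Fin n) → EReal} {x z v : EuclideanSpace ℝ (Fin n)}

theorem mem_effDom_of_le_coe {c : ℝ} (h : f x ≤ c) : x ∈ effDom f :=
  h.trans_lt (EReal.coe_lt_top c)

theorem IsProperFun.coe_toReal (hf : IsProperFun f) (hx : x ∈ effDom f) :
    ((f x).toReal : EReal) = f x :=
  EReal.coe_toReal (ne_of_lt hx) (hf.1 x)

theorem IsProperFun.toReal_le_of_le_coe (hf : IsProperFun f) {c : ℝ} (h : f x ≤ c) :
    (f x).toReal ≤ c :=
  EReal.toReal_le_toReal h (hf.1 x) (EReal.coe_ne_top c)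

theorem IsProperFun.convexOn_toReal (hf : IsProperFun f) (hc : IsConvexFun f) :
    ConvexOn ℝ (effDom f) (fun y => (f y).toReal) := by
  have hle : ∀ x ∈ effDom f, ∀ y ∈ effDom f, ∀ a b : ℝ, 0 ≤ a → 0 ≤ b → a + b = 1 →
      f (a • x + b • y) ≤ ((a * (f x).toReal + b * (f y).toReal : ℝ) : EReal) :=
    fun x hx y hy a b ha hb hab =>
      hc (show (x, (f x).toReal) ∈ epigraph f from (hf.coe_toReal hx).ge)
        (show (y, (f y).toReal) ∈ epigraph f from (hf.coe_toReal hy).ge) ha hb hab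
  exact ⟨fun x hx y hy a b ha hb hab => mem_effDom_of_le_coe (hle x hx y hy a b ha hb hab),
    fun x hx y hy a b ha hb hab => hf.toReal_le_of_le_coe (hle x hx y hy a b ha hb hab)⟩

theorem IsProperFun.mem_subdiff_iff (hf : IsProperFun f) : v ∈ subdiff f x ↔
    x ∈ effDom f ∧ IsSubgradientOn (fun y => (f y).toReal) (effDom f) x v := by
  constructor
  · intro hv
    have hx : x ∈ effDom f := by
      obtain ⟨y, hy⟩ := hf.2
      refine (lt_top_iff_ne_top (α := EReal)).2 fun htop => (hv y).not_gt ?_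
      rwa [htop, EReal.top_add_coe]
    refine ⟨hx, fun y hy => ?_⟩
    have hle := hv y
    rw [← hf.coe_toReal hx, ← hf.coe_toReal hy] at hle
    exact_mod_cast hle
  · rintro ⟨hx, hv⟩ y
    by_cases hy : y ∈ effDom f
    · rw [← hf.coe_toReal hx, ← hf.coe_toReal hy]
      exact_mod_cast hv y hy
    · rw [show f y = ⊤ from not_lt_top_iff.1 hy]
      exact le_top

theorem le_coe_sub_comm {r : ℝ} {a b : EReal} : a ≤ (r : EReal) - b ↔ b ≤ (r : EReal) - a := by
  rw [EReal.le_sub_iff_add_le (.inr (EReal.coe_ne_bot r)) (.inr (EReal.coe_ne_top r)), add_comm,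
    EReal.le_sub_iff_add_le (.inr (EReal.coe_ne_bot r)) (.inr (EReal.coe_ne_top r))]

theorem coe_sub_le_comm {r : ℝ} {a b : EReal} : (r : EReal) - a ≤ b ↔ (r : EReal) - b ≤ a := by
  induction a <;> induction b <;> simp [← EReal.coe_sub, add_comm]

theorem coe_sub_coe_sub {r s : ℝ} {a : EReal} :
    (r : EReal) - (s - a) = a + ((r - s : ℝ) : EReal) := by
  rw [sub_eq_add_neg, EReal.neg_sub (.inl (EReal.coe_ne_bot s)) (.inl (EReal.coe_ne_top s)),
    EReal.coe_sub, sub_eq_add_neg]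
  ac_rfl

theorem mem_subdiff_iff_forall_inner_sub_le :
    v ∈ subdiff f x ↔ ∀ y, (⟪y, v⟫_ℝ : EReal) - f y ≤ (⟪x, v⟫_ℝ : EReal) - f x := by
  refine forall_congr' fun y => ?_
  rw [coe_sub_le_comm, coe_sub_coe_sub, ← inner_sub_left, real_inner_comm]

theorem IsClosedFun.mem_subdiff_of_tendsto (hf : IsClosedFun f) {ι : Type*} {l : Filter ι}
    [l.NeBot] {u w : ι → EuclideanSpace ℝ (Fin n)} (hmem : ∀ i, w i ∈ subdiff f (u i))
    (hu : Tendsto u l (𝓝 x)) (hw : Tendsto w l (𝓝 v)) : v ∈ subdiff f x := by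
  have hadd : ∀ (a : EReal) (b c : ℝ), a + b ≤ c ↔ a ≤ ((c - b : ℝ) : EReal) := fun a b c => by
    rw [EReal.coe_sub, EReal.le_sub_iff_add_le (.inl (EReal.coe_ne_bot b))
      (.inl (EReal.coe_ne_top b))]
  refine fun y => EReal.le_of_forall_lt_iff_le.1 fun q hq => (hadd _ _ _).2 ?_
  have hlim : Tendsto (fun i => (u i, q - ⟪w i, y - u i⟫_ℝ)) l (𝓝 (x, q - ⟪v, y - x⟫_ℝ)) :=
    hu.prodMk_nhds (tendsto_const_nhds.sub (hw.inner (tendsto_const_nhds.sub hu)))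
  exact hf.mem_of_tendsto hlim
    (Eventually.of_forall fun i => (hadd _ _ _).1 ((hmem i y).trans hq.le))

theorem IsClosedFun.upperSemicontinuous_inner_sub (hf : IsClosedFun f) :
    UpperSemicontinuous fun x => (⟪x, z⟫_ℝ : EReal) - f x := by
  intro x b hb
  obtain ⟨q, hxq, hqb⟩ := EReal.lt_iff_exists_real_btwn.1 hb
  have hclosed : IsClosed {y | (q : EReal) ≤ (⟪y, z⟫_ℝ : EReal) - f y} := by
    have hpre : {y | (q : EReal) ≤ (⟪y, z⟫_ℝ : EReal) - f y} =
        (fun y => (y, ⟪y, z⟫_ℝ - q)) ⁻¹' epigraph f :=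
      Set.ext fun y => le_coe_sub_comm
    rw [hpre]
    exact IsClosed.preimage (by fun_prop) hf
  filter_upwards [hclosed.isOpen_compl.mem_nhds (not_le.2 hxq)] with y hy
  rw [mem_compl_iff, mem_ofPred_eq, not_le] at hy
  exact hy.trans hqb

theorem IsClosedFun.exists_mem_subdiff (hf : IsClosedFun f)
    (hlim : Tendsto (fun x => (⟪x, z⟫_ℝ : EReal) - f x)
      (Bornology.cobounded (EuclideanSpace ℝ (Fin n))) (𝓝 ⊥)) : ∃ x, z ∈ subdiff f x := by
  rw [Metric.cobounded_eq_cocompact] at hlim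
  obtain ⟨x, hx⟩ := exists_forall_ge_of_tendsto_cocompact hf.upperSemicontinuous_inner_sub hlim
  exact ⟨x, mem_subdiff_iff_forall_inner_sub_le.2 hx⟩

end ExtendedReal

section Conjugate

variable {n : ℕ} {f : EuclideanSpace ℝ (Fin n) → EReal} {x z : EuclideanSpace ℝ (Fin n)}

theorem epigraph_conjugate (f : EuclideanSpace ℝ (Fin n) → EReal) :
    epigraph (conjugate f) =
      ⋂ p ∈ epigraph f, {q : EuclideanSpace ℝ (Fin n) × ℝ | ⟪p.1, q.1⟫_ℝ - p.2 ≤ q.2} := by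
  ext ⟨z, t⟩
  simp only [epigraph, conjugate, mem_ofPred_eq, iSup_le_iff, mem_iInter, Prod.forall]
  refine forall_congr' fun x => ?_
  induction f x with
  | bot => simpa using ⟨⟪x, z⟫_ℝ - t - 1, by linarith⟩
  | top => simp
  | coe a =>
    norm_cast
    exact ⟨fun h b hb => by linarith, fun h => h a le_rfl⟩

theorem isClosedFun_conjugate : IsClosedFun (conjugate f) := by
  rw [IsClosedFun, epigraph_conjugate]
  exact isClosed_biInter fun p _ => isClosed_le (by fun_prop) (by fun_prop)

theorem isConvexFun_conjugate : IsConvexFun (conjugate f) := by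
  rw [IsConvexFun, epigraph_conjugate]
  refine convex_iInter₂ fun p _ => ?_
  simpa using (((innerₗ _ p.1).convexOn convex_univ).add_const (-p.2)).convex_epigraph

theorem inner_sub_le_conjugate (f : EuclideanSpace ℝ (Fin n) → EReal)
    (x z : EuclideanSpace ℝ (Fin n)) : (⟪x, z⟫_ℝ : EReal) - f x ≤ conjugate f z :=
  le_iSup (fun x => (⟪x, z⟫_ℝ : EReal) - f x) x

theorem mem_subdiff_iff_conjugate_eq :
    z ∈ subdiff f x ↔ conjugate f z = (⟪x, z⟫_ℝ : EReal) - f x := by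
  rw [mem_subdiff_iff_forall_inner_sub_le, ← (inner_sub_le_conjugate f x z).ge_iff_eq', conjugate,
    iSup_le_iff]

theorem mem_subdiff_conjugate_of_mem_subdiff (h : z ∈ subdiff f x) :
    x ∈ subdiff (conjugate f) z := by
  refine mem_subdiff_iff_forall_inner_sub_le.2 fun w => ?_
  rw [mem_subdiff_iff_conjugate_eq.1 h, real_inner_comm x w, real_inner_comm x z]
  exact (coe_sub_le_comm.1 (inner_sub_le_conjugate f x w)).trans (le_coe_sub_comm.1 le_rfl)

theorem IsProperFun.mem_effDom_conjugate_of_mem_subdiff (hf : IsProperFun f)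
    (h : z ∈ subdiff f x) : z ∈ effDom (conjugate f) := by
  rw [effDom, mem_ofPred_eq, mem_subdiff_iff_conjugate_eq.1 h,
    ← hf.coe_toReal (hf.mem_subdiff_iff.1 h).1, ← EReal.coe_sub]
  exact EReal.coe_lt_top _

theorem IsProperFun.isProperFun_conjugate (hf : IsProperFun f) (hz : z ∈ effDom (conjugate f)) :
    IsProperFun (conjugate f) := by
  obtain ⟨x, hx⟩ := hf.2
  refine ⟨fun w => ne_bot_of_le_ne_bot ?_ (inner_sub_le_conjugate f x w), z, hz⟩
  rw [← hf.coe_toReal hx, ← EReal.coe_sub]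
  exact EReal.coe_ne_bot _

theorem IsProperFun.mem_mirrorArgmax_iff (hf : IsProperFun f) :
    x ∈ mirrorArgmax f z ↔ z ∈ subdiff f x := by
  rw [mem_subdiff_iff_forall_inner_sub_le]
  refine ⟨fun h y => ?_, fun h => ⟨?_, fun y _ => h y⟩⟩
  · by_cases hy : y ∈ effDom f
    · exact h.2 y hy
    · simp [show f y = ⊤ from not_lt_top_iff.1 hy]
  · exact (hf.mem_subdiff_iff.1 (mem_subdiff_iff_forall_inner_sub_le.2 h)).1

theorem IsProperFun.effDom_conjugate_eq_univ (hf : IsProperFun f)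
    (h : ∀ z, (mirrorArgmax f z).Nonempty) : effDom (conjugate f) = univ :=
  eq_univ_of_forall fun z =>
    let ⟨_, hx⟩ := h z
    hf.mem_effDom_conjugate_of_mem_subdiff (hf.mem_mirrorArgmax_iff.1 hx)

theorem tendsto_bot_of_eventually_le_sub_norm {E : Type*} [SeminormedAddGroup E] {g : E → EReal}
    {r M : ℝ} (hr : 0 < r)
    (hg : ∀ᶠ x in Bornology.cobounded E, g x ≤ ((M - r * ‖x‖ : ℝ) : EReal)) :
    Tendsto g (Bornology.cobounded E) (𝓝 ⊥) := by
  refine EReal.tendsto_nhds_bot_iff_real.2 fun c => ?_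
  filter_upwards [hg, tendsto_norm_cobounded_atTop.eventually_gt_atTop ((M - c) / r)] with x hx hxc
  refine hx.trans_lt (EReal.coe_lt_coe_iff.2 ?_)
  rw [div_lt_iff₀ hr] at hxc
  linarith

theorem tendsto_inner_sub_of_mem_interior_effDom_conjugate (hf : IsProperFun (conjugate f))
    (hz : z ∈ interior (effDom (conjugate f))) :
    Tendsto (fun x => (⟪x, z⟫_ℝ : EReal) - f x)
      (Bornology.cobounded (EuclideanSpace ℝ (Fin n))) (𝓝 ⊥) := by
  obtain ⟨r, hr, M, hball⟩ :=
    exists_forall_mem_closedBall_le (hf.convexOn_toReal isConvexFun_conjugate) hz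
  refine tendsto_bot_of_eventually_le_sub_norm (M := M) hr (Eventually.of_forall fun x => ?_)
  obtain ⟨w, hwr, hxw⟩ := exists_norm_le_inner_eq_mul_norm x hr.le
  obtain ⟨hdom, hM⟩ := hball (z + w) (by simpa using hwr)
  have hle := inner_sub_le_conjugate f x (z + w)
  rw [← hf.coe_toReal hdom] at hle
  refine coe_sub_le_comm.1 (le_trans ?_ (coe_sub_le_comm.1
    (hle.trans (EReal.coe_le_coe_iff.2 hM))))
  rw [← EReal.coe_sub, ← EReal.coe_sub, EReal.coe_le_coe_iff, inner_add_right, hxw]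
  linarith

theorem IsSupercoercive.tendsto_inner_sub (hf : IsSupercoercive f) :
    Tendsto (fun x => (⟪x, z⟫_ℝ : EReal) - f x)
      (Bornology.cobounded (EuclideanSpace ℝ (Fin n))) (𝓝 ⊥) := by
  refine tendsto_bot_of_eventually_le_sub_norm (M := 0) one_pos ?_
  filter_upwards [hf.eventually_const_lt (EReal.coe_lt_top (‖z‖ + 1)),
    tendsto_norm_cobounded_atTop.eventually_gt_atTop 0] with x hx hpos
  rw [EReal.lt_div_iff (EReal.coe_pos.2 hpos) (EReal.coe_ne_top _)] at hx
  refine coe_sub_le_comm.1 (le_trans ?_ hx.le)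
  rw [← EReal.coe_sub, ← EReal.coe_mul, EReal.coe_le_coe_iff]
  linarith [real_inner_le_norm x z]

theorem IsSupercoercive.mirrorArgmax_nonempty (hs : IsSupercoercive f) (hc : IsClosedFun f)
    (hp : IsProperFun f) : (mirrorArgmax f z).Nonempty :=
  let ⟨x, hx⟩ := hc.exists_mem_subdiff hs.tendsto_inner_sub
  ⟨x, hp.mem_mirrorArgmax_iff.2 hx⟩

end Conjugate

section EssentiallySmooth

variable {n : ℕ} {f : EuclideanSpace ℝ (Fin n) → EReal} {x y v : EuclideanSpace ℝ (Fin n)}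

theorem IsProperFun.grad_mem_subdiff (hf : IsProperFun f) (hc : IsConvexFun f) (hx : x ∈ effDom f)
    (hd : DifferentiableAt ℝ (fun y => (f y).toReal) x) : grad f x ∈ subdiff f x :=
  hf.mem_subdiff_iff.2 ⟨hx, isSubgradientOn_gradient (hf.convexOn_toReal hc) hx hd⟩

theorem IsProperFun.exists_norm_grad_le (hf : IsProperFun f) (hc : IsConvexFun f)
    (hd : ∀ y ∈ interior (effDom f), DifferentiableAt ℝ (fun y => (f y).toReal) y)
    (hv : v ∈ subdiff f x) (hy : y ∈ interior (effDom f)) :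
    ∃ K, ∀ t ∈ Ioc (0 : ℝ) 1, ‖grad f (x + t • (y - x))‖ ≤ K := by
  have hF := hf.convexOn_toReal hc
  obtain ⟨hx, hvx⟩ := hf.mem_subdiff_iff.1 hv
  obtain ⟨r, hr, M, hball⟩ := exists_forall_mem_closedBall_le hF hy
  refine ⟨(M - (f x).toReal - ⟪v, y - x⟫_ℝ) / r, fun t ht => ?_⟩
  have hpint : x + t • (y - x) ∈ interior (effDom f) := hF.1.add_smul_sub_mem_interior hx hy ht
  have hp := interior_subset hpint
  rw [le_div_iff₀' hr]
  exact hvx.mul_norm_le (isSubgradientOn_gradient hF hp (hd _ hpint)) hx hp ht.1 ht.2 hr.le hball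

theorem IsEssentiallySmooth.mem_interior_of_mem_subdiff (hs : IsEssentiallySmooth f)
    (hf : IsProperFun f) (hc : IsConvexFun f) (hv : v ∈ subdiff f x) :
    x ∈ interior (effDom f) := by
  by_contra hx
  obtain ⟨y, hy⟩ := hs.interior_nonempty
  obtain ⟨K, hK⟩ := hf.exists_norm_grad_le hc hs.differentiableAt hv hy
  have hxD : x ∈ effDom f := (hf.mem_subdiff_iff.1 hv).1
  set t : ℕ → ℝ := fun k => 1 / ((k : ℝ) + 1)
  have ht : ∀ k, t k ∈ Ioc (0 : ℝ) 1 := fun k => ⟨Nat.one_div_pos_of_nat, by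
    simpa [t] using Nat.one_div_le_one_div (α := ℝ) k.zero_le⟩
  have hlim : Tendsto (fun k => x + t k • (y - x)) atTop (𝓝 x) := by
    simpa [t] using
      ((tendsto_one_div_add_atTop_nhds_zero_nat (𝕜 := ℝ)).smul_const (y - x)).const_add x
  have hsteep := hs.steep _ x
    (fun k => (hf.convexOn_toReal hc).1.add_smul_sub_mem_interior hxD hy (ht k))
    ⟨subset_closure hxD, hx⟩ hlim
  obtain ⟨k, hk⟩ := (hsteep.eventually_gt_atTop K).exists
  exact (hK _ (ht k)).not_gt hk

theorem IsEssentiallySmooth.mem_subdiff_iff (hs : IsEssentiallySmooth f) (hf : IsProperFun f)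
    (hc : IsConvexFun f) : v ∈ subdiff f x ↔ x ∈ interior (effDom f) ∧ v = grad f x := by
  constructor
  · intro hv
    have hx := hs.mem_interior_of_mem_subdiff hf hc hv
    exact ⟨hx, (hf.mem_subdiff_iff.1 hv).2.eq_gradient (mem_interior_iff_mem_nhds.1 hx)
      (hs.differentiableAt x hx)⟩
  · rintro ⟨hx, rfl⟩
    exact hf.grad_mem_subdiff hc (interior_subset hx) (hs.differentiableAt x hx)

end EssentiallySmooth

namespace IsLegendre

variable {n : ℕ} {f : EuclideanSpace ℝ (Fin n) → EReal} {x z v : EuclideanSpace ℝ (Fin n)}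

theorem mem_subdiff_iff (hf : IsLegendre f) :
    v ∈ subdiff f x ↔ x ∈ interior (effDom f) ∧ v = grad f x :=
  hf.essentiallySmooth.mem_subdiff_iff hf.isProperFun hf.isConvexFun

theorem grad_mem_subdiff (hf : IsLegendre f) (hx : x ∈ interior (effDom f)) :
    grad f x ∈ subdiff f x :=
  hf.mem_subdiff_iff.2 ⟨hx, rfl⟩

theorem convexOn_toReal (hf : IsLegendre f) :
    ConvexOn ℝ (effDom f) (fun y => (f y).toReal) :=
  hf.isProperFun.convexOn_toReal hf.isConvexFun

theorem strictConvexOn_interior (hf : IsLegendre f) :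
    StrictConvexOn ℝ (interior (effDom f)) (fun y => (f y).toReal) :=
  hf.essentiallyStrictlyConvex _ (fun _ hx => ⟨_, hf.grad_mem_subdiff hx⟩)
    hf.convexOn_toReal.1.interior

theorem isSubgradientOn_grad (hf : IsLegendre f) (hx : x ∈ interior (effDom f)) :
    IsSubgradientOn (fun y => (f y).toReal) (interior (effDom f)) x (grad f x) := fun y hy =>
  (hf.isProperFun.mem_subdiff_iff.1 (hf.grad_mem_subdiff hx)).2 y (interior_subset hy)

theorem strictlyMonotoneOn_grad (hf : IsLegendre f) :
    StrictlyMonotoneOn (grad f) (interior (effDom f)) := fun _ hx _ hy hne =>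
  (hf.isSubgradientOn_grad hx).inner_sub_pos (hf.isSubgradientOn_grad hy)
    hf.strictConvexOn_interior hx hy hne

theorem nhds_grad_le_map_grad (hf : IsLegendre f) (hx : x ∈ interior (effDom f)) :
    𝓝 (grad f x) ≤ map (grad f) (𝓝 x) := by
  intro V hV
  obtain ⟨r, hr, hball⟩ := Metric.nhds_basis_closedBall.mem_iff.1
    (inter_mem (mem_map.1 hV) (isOpen_interior.mem_nhds hx))
  have hsphere : ∀ y ∈ Metric.sphere x r,
      (f x).toReal + ⟪grad f x, y - x⟫_ℝ < (f y).toReal := fun y hy =>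
    (hf.isSubgradientOn_grad hx).add_inner_lt hf.strictConvexOn_interior hx
      (hball (Metric.sphere_subset_closedBall hy)).2 (Metric.ne_of_mem_sphere hy hr.ne')
  filter_upwards [eventually_exists_mem_ball_isSubgradientOn hf.convexOn_toReal hr
    (hball.trans inter_subset_right) hsphere] with w ⟨y, hy, hwy⟩
  obtain ⟨hyV, hyD⟩ := hball (Metric.ball_subset_closedBall hy)
  have hw : w ∈ subdiff f y := hf.isProperFun.mem_subdiff_iff.2 ⟨interior_subset hyD, hwy⟩
  rw [(hf.mem_subdiff_iff.1 hw).2]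
  exact hyV

theorem eventually_exists_mem_subdiff (hf : IsLegendre f) (hz : z ∈ subdiff f x)
    {U : Set (EuclideanSpace ℝ (Fin n))} (hU : U ∈ 𝓝 x) :
    ∀ᶠ w in 𝓝 z, ∃ y ∈ U, w ∈ subdiff f y := by
  obtain ⟨hx, rfl⟩ := hf.mem_subdiff_iff.1 hz
  filter_upwards [hf.nhds_grad_le_map_grad hx
    (image_mem_map (inter_mem hU (isOpen_interior.mem_nhds hx)))] with w ⟨y, ⟨hyU, hy⟩, hyw⟩
  exact ⟨y, hyU, hyw ▸ hf.grad_mem_subdiff hy⟩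

theorem mem_interior_effDom_conjugate (hf : IsLegendre f) (hz : z ∈ subdiff f x) :
    z ∈ interior (effDom (conjugate f)) := by
  rw [mem_interior_iff_mem_nhds]
  filter_upwards [hf.eventually_exists_mem_subdiff hz univ_mem] with w ⟨y, _, hy⟩
  exact hf.isProperFun.mem_effDom_conjugate_of_mem_subdiff hy

theorem grad_mem_interior (hf : IsLegendre f) (hx : x ∈ interior (effDom f)) :
    grad f x ∈ interior (effDom (conjugate f)) :=
  hf.mem_interior_effDom_conjugate (hf.grad_mem_subdiff hx)

theorem isProperFun_conjugate (hf : IsLegendre f) : IsProperFun (conjugate f) :=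
  let ⟨_, hx⟩ := hf.essentiallySmooth.interior_nonempty
  hf.isProperFun.isProperFun_conjugate (interior_subset (hf.grad_mem_interior hx))

theorem hasGradientAt_conjugate (hf : IsLegendre f) (hz : z ∈ subdiff f x) :
    HasGradientAt (fun w => (conjugate f w).toReal) x z := by
  have hsub : ∀ {y w}, w ∈ subdiff f y → w ∈ effDom (conjugate f) ∧
      IsSubgradientOn (fun w => (conjugate f w).toReal) (effDom (conjugate f)) w y := fun hw =>
    hf.isProperFun_conjugate.mem_subdiff_iff.1 (mem_subdiff_conjugate_of_mem_subdiff hw)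
  refine (hsub hz).2.hasGradientAt (hsub hz).1 fun c hc => ?_
  filter_upwards [hf.eventually_exists_mem_subdiff hz (Metric.ball_mem_nhds x hc)]
    with w ⟨y, hyx, hw⟩
  exact ⟨(hsub hw).1, y, hyx, (hsub hw).2⟩

theorem grad_conjugate_eq (hf : IsLegendre f) (hz : z ∈ subdiff f x) :
    grad (conjugate f) z = x :=
  (hf.hasGradientAt_conjugate hz).gradient

theorem exists_mem_subdiff (hf : IsLegendre f) (hz : z ∈ interior (effDom (conjugate f))) :
    ∃ x, z ∈ subdiff f x :=
  hf.isClosedFun.exists_mem_subdiff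
    (tendsto_inner_sub_of_mem_interior_effDom_conjugate hf.isProperFun_conjugate hz)

theorem mem_subdiff_grad_conjugate (hf : IsLegendre f)
    (hz : z ∈ interior (effDom (conjugate f))) : z ∈ subdiff f (grad (conjugate f) z) := by
  obtain ⟨x, hx⟩ := hf.exists_mem_subdiff hz
  rwa [hf.grad_conjugate_eq hx]

theorem essentiallySmooth_conjugate (hf : IsLegendre f) : IsEssentiallySmooth (conjugate f) where
  interior_nonempty :=
    let ⟨_, hx⟩ := hf.essentiallySmooth.interior_nonempty
    ⟨_, hf.grad_mem_interior hx⟩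
  differentiableAt _ hz :=
    (hf.hasGradientAt_conjugate (hf.mem_subdiff_grad_conjugate hz)).differentiableAt
  -- A bounded subsequence of gradients would converge to some `x` with `b ∈ ∂f(x)`, by the closed
  -- graph of `∂f`, but all subgradients of `f` are interior points of `dom f⋆`.
  steep w b hw hb hlim := by
    by_contra hnot
    obtain ⟨K, hK⟩ : ∃ K : ℝ, ∃ᶠ k in atTop, ‖grad (conjugate f) (w k)‖ < K := by
      rw [tendsto_atTop] at hnot
      push Not at hnot
      exact hnot
    obtain ⟨x, -, φ, hφ, hx⟩ := tendsto_subseq_of_frequently_bounded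
      (Metric.isBounded_ball (x := (0 : EuclideanSpace ℝ (Fin n))) (r := K))
      (hK.mono fun k hk => mem_ball_zero_iff.2 hk)
    have hbx : b ∈ subdiff f x := hf.isClosedFun.mem_subdiff_of_tendsto
      (fun k => hf.mem_subdiff_grad_conjugate (hw (φ k))) hx (hlim.comp hφ.tendsto_atTop)
    exact hb.2 (hf.mem_interior_effDom_conjugate hbx)

theorem add_inner_grad_conjugate_lt (hf : IsLegendre f) {w : EuclideanSpace ℝ (Fin n)}
    (hz : z ∈ interior (effDom (conjugate f))) (hw : w ∈ effDom (conjugate f)) (hne : w ≠ z) :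
    (conjugate f z).toReal + ⟪grad (conjugate f) z, w - z⟫_ℝ < (conjugate f w).toReal := by
  have hzx := hf.mem_subdiff_grad_conjugate hz
  set x := grad (conjugate f) z
  have hproper := hf.isProperFun_conjugate
  refine ((hproper.mem_subdiff_iff.1 (mem_subdiff_conjugate_of_mem_subdiff hzx)).2 w hw).lt_of_ne
    fun heq => hne ?_
  beta_reduce at heq
  have hwx : w ∈ subdiff f x := by
    have hfx := hf.isProperFun.coe_toReal (hf.isProperFun.mem_subdiff_iff.1 hzx).1
    have hzeq := mem_subdiff_iff_conjugate_eq.1 hzx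
    rw [← hfx, ← EReal.coe_sub] at hzeq
    rw [mem_subdiff_iff_conjugate_eq, ← hproper.coe_toReal hw, ← heq, hzeq, EReal.toReal_coe,
      ← hfx, ← EReal.coe_sub, EReal.coe_eq_coe_iff, EReal.toReal_coe, inner_sub_right]
    ring
  rw [(hf.mem_subdiff_iff.1 hwx).2, (hf.mem_subdiff_iff.1 hzx).2]

theorem essentiallyStrictlyConvex_conjugate (hf : IsLegendre f) :
    IsEssentiallyStrictlyConvex (conjugate f) := by
  intro S hS hconv
  have hSint : S ⊆ interior (effDom (conjugate f)) := fun z hz =>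
    let ⟨_, hv⟩ := hS hz
    hf.essentiallySmooth_conjugate.mem_interior_of_mem_subdiff hf.isProperFun_conjugate
      isConvexFun_conjugate hv
  exact strictConvexOn_of_forall_exists_add_inner_lt hconv fun z hz => ⟨_, fun w hw hne =>
    hf.add_inner_grad_conjugate_lt (hSint hz) (interior_subset (hSint hw)) hne⟩

theorem isLegendre_conjugate (hf : IsLegendre f) : IsLegendre (conjugate f) where
  isClosedFun := isClosedFun_conjugate
  isProperFun := hf.isProperFun_conjugate
  isConvexFun := isConvexFun_conjugate
  essentiallySmooth := hf.essentiallySmooth_conjugate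
  essentiallyStrictlyConvex := hf.essentiallyStrictlyConvex_conjugate

theorem grad_conjugate_mem_interior (hf : IsLegendre f)
    (hz : z ∈ interior (effDom (conjugate f))) : grad (conjugate f) z ∈ interior (effDom f) :=
  (hf.mem_subdiff_iff.1 (hf.mem_subdiff_grad_conjugate hz)).1

theorem grad_grad_conjugate (hf : IsLegendre f) (hz : z ∈ interior (effDom (conjugate f))) :
    grad f (grad (conjugate f) z) = z :=
  (hf.mem_subdiff_iff.1 (hf.mem_subdiff_grad_conjugate hz)).2.symm

theorem grad_conjugate_grad (hf : IsLegendre f) (hx : x ∈ interior (effDom f)) :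
    grad (conjugate f) (grad f x) = x :=
  hf.grad_conjugate_eq (hf.grad_mem_subdiff hx)

theorem continuousAt_grad_conjugate (hf : IsLegendre f)
    (hz : z ∈ interior (effDom (conjugate f))) : ContinuousAt (grad (conjugate f)) z := by
  have hx := hf.grad_conjugate_mem_interior hz
  rw [← hf.grad_grad_conjugate hz]
  exact continuousAt_of_nhds_le_map (hf.nhds_grad_le_map_grad hx)
    (eventually_of_mem (isOpen_interior.mem_nhds hx) fun _ => hf.grad_conjugate_grad)

theorem continuousAt_grad (hf : IsLegendre f) (hx : x ∈ interior (effDom f)) :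
    ContinuousAt (grad f) x := by
  have hz := hf.grad_mem_interior hx
  rw [← hf.grad_conjugate_grad hx]
  exact continuousAt_of_nhds_le_map (hf.isLegendre_conjugate.nhds_grad_le_map_grad hz)
    (eventually_of_mem (isOpen_interior.mem_nhds hz) fun _ => hf.grad_grad_conjugate)

/-- The gradient of a Legendre function `f` as a homeomorphism between the interiors of the domains
of `f` and of its conjugate, with the gradient of the conjugate as inverse. -/
noncomputable def gradHomeomorph (hf : IsLegendre f) :
    interior (effDom f) ≃ₜ interior (effDom (conjugate f)) where
  toFun x := ⟨grad f x, hf.grad_mem_interior x.2⟩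
  invFun z := ⟨grad (conjugate f) z, hf.grad_conjugate_mem_interior z.2⟩
  left_inv x := Subtype.ext (hf.grad_conjugate_grad x.2)
  right_inv z := Subtype.ext (hf.grad_grad_conjugate z.2)
  continuous_toFun := (continuousOn_iff_continuous_domRestrict.1 fun _ hx =>
    (hf.continuousAt_grad hx).continuousWithinAt).subtype_mk _
  continuous_invFun := (continuousOn_iff_continuous_domRestrict.1 fun _ hz =>
    (hf.continuousAt_grad_conjugate hz).continuousWithinAt).subtype_mk _

theorem mirrorArgmax_eq (hf : IsLegendre f) (hz : z ∈ interior (effDom (conjugate f))) :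
    mirrorArgmax f z = {grad (conjugate f) z} := by
  ext x
  rw [hf.isProperFun.mem_mirrorArgmax_iff, mem_singleton_iff]
  exact ⟨fun h => (hf.grad_conjugate_eq h).symm, fun h => h ▸ hf.mem_subdiff_grad_conjugate hz⟩

theorem mirrorMap_eq (hf : IsLegendre f) (hz : z ∈ interior (effDom (conjugate f))) :
    mirrorMap f z = grad (conjugate f) z := by
  have hargmax := hf.mirrorArgmax_eq hz
  have hmem : mirrorMap f z ∈ mirrorArgmax f z :=
    Classical.epsilon_spec (hargmax ▸ singleton_nonempty _ : (mirrorArgmax f z).Nonempty)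
  rwa [hargmax] at hmem

theorem strictlyMonotoneOn_mirrorMap (hf : IsLegendre f) :
    StrictlyMonotoneOn (mirrorMap f) (interior (effDom (conjugate f))) := by
  intro z hz w hw hne
  rw [hf.mirrorMap_eq hz, hf.mirrorMap_eq hw]
  exact hf.isLegendre_conjugate.strictlyMonotoneOn_grad z hz w hw hne

end IsLegendre

section Scaling

variable {n : ℕ} {f : EuclideanSpace ℝ (Fin n) → EReal} {x v : EuclideanSpace ℝ (Fin n)} {ε : ℝ}

theorem coe_mul_le_coe_mul_iff (hε : 0 < ε) {a b : EReal} :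
    (ε : EReal) * a ≤ (ε : EReal) * b ↔ a ≤ b := by
  have hcancel : ∀ c : EReal, ((ε⁻¹ : ℝ) : EReal) * ((ε : EReal) * c) = c := fun c => by
    rw [← mul_assoc, ← EReal.coe_mul, inv_mul_cancel₀ hε.ne', EReal.coe_one, one_mul]
  refine ⟨fun h => ?_, fun h => mul_le_mul_of_nonneg_left h (EReal.coe_nonneg.2 hε.le)⟩
  simpa only [hcancel] using
    mul_le_mul_of_nonneg_left h (EReal.coe_nonneg.2 (inv_pos.2 hε).le)

theorem epigraph_const_mul (hε : 0 < ε) : epigraph (fun x => (ε : EReal) * f x) =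
    (LinearMap.prodMap LinearMap.id (ε⁻¹ • LinearMap.id) :
      EuclideanSpace ℝ (Fin n) × ℝ →ₗ[ℝ] EuclideanSpace ℝ (Fin n) × ℝ) ⁻¹' epigraph f := by
  ext ⟨x, t⟩
  simp only [epigraph, mem_ofPred_eq, mem_preimage, LinearMap.prodMap_apply, LinearMap.id_apply,
    LinearMap.smul_apply, smul_eq_mul]
  rw [← coe_mul_le_coe_mul_iff hε (a := f x), ← EReal.coe_mul, mul_inv_cancel_left₀ hε.ne']

theorem effDom_const_mul (hε : 0 < ε) : effDom (fun x => (ε : EReal) * f x) = effDom f := by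
  ext x
  rw [effDom, mem_ofPred_eq, ← EReal.coe_mul_top_of_pos hε]
  exact lt_iff_lt_of_le_iff_le (coe_mul_le_coe_mul_iff hε)

theorem toReal_const_mul (ε : ℝ) (f : EuclideanSpace ℝ (Fin n) → EReal) :
    (fun x => ((ε : EReal) * f x).toReal) = ε • fun x => (f x).toReal := by
  funext x
  rw [EReal.toReal_mul, EReal.toReal_coe, Pi.smul_apply, smul_eq_mul]

theorem grad_const_mul (ε : ℝ) (f : EuclideanSpace ℝ (Fin n) → EReal)
    (x : EuclideanSpace ℝ (Fin n)) :
    grad (fun y => (ε : EReal) * f y) x = ε • grad f x := by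
  rw [grad, toReal_const_mul, grad, gradient, gradient, fderiv_const_smul_field, Pi.smul_apply,
    map_smul]

theorem mem_subdiff_const_mul_iff (hε : 0 < ε) :
    v ∈ subdiff (fun y => (ε : EReal) * f y) x ↔ ε⁻¹ • v ∈ subdiff f x := by
  refine forall_congr' fun y => ?_
  have hinner : ⟪v, y - x⟫_ℝ = ε * ⟪ε⁻¹ • v, y - x⟫_ℝ := by
    rw [real_inner_smul_left, mul_inv_cancel_left₀ hε.ne']
  rw [hinner, EReal.coe_mul, ← EReal.left_distrib_of_nonneg_of_ne_top (EReal.coe_nonneg.2 hε.le)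
    (EReal.coe_ne_top ε)]
  exact coe_mul_le_coe_mul_iff hε

theorem domSubdiff_const_mul (hε : 0 < ε) :
    domSubdiff (fun x => (ε : EReal) * f x) = domSubdiff f := by
  ext x
  have hpre : subdiff (fun y => (ε : EReal) * f y) x = (ε⁻¹ • ·) ⁻¹' subdiff f x :=
    Set.ext fun _ => mem_subdiff_const_mul_iff hε
  rw [domSubdiff, mem_ofPred_eq, hpre]
  exact (MulAction.surjective₀ (inv_ne_zero hε.ne')).nonempty_preimage

theorem IsProperFun.const_mul (hf : IsProperFun f) (hε : 0 < ε) :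
    IsProperFun fun x => (ε : EReal) * f x := by
  refine ⟨fun x => (EReal.mul_ne_bot _ _).2 (by simp [hf.1 x, hε.le]), ?_⟩
  obtain ⟨x, hx⟩ := hf.2
  exact ⟨x, (effDom_const_mul hε).ge hx⟩

theorem IsClosedFun.const_mul (hf : IsClosedFun f) (hε : 0 < ε) :
    IsClosedFun fun x => (ε : EReal) * f x := by
  rw [IsClosedFun, epigraph_const_mul hε]
  exact hf.preimage (LinearMap.continuous_of_finiteDimensional _)

theorem IsConvexFun.const_mul (hf : IsConvexFun f) (hε : 0 < ε) :
    IsConvexFun fun x => (ε : EReal) * f x := by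
  rw [IsConvexFun, epigraph_const_mul hε]
  exact hf.linear_preimage _

theorem IsSupercoercive.const_mul (hf : IsSupercoercive f) (hε : 0 < ε) :
    IsSupercoercive fun x => (ε : EReal) * f x := by
  have hlim := EReal.Tendsto.const_mul (a := (ε : EReal)) hf (.inl (by simp)) (.inl (by simp))
  simp only [EReal.coe_mul_top_of_pos hε, EReal.mul_div] at hlim
  exact hlim

theorem IsEssentiallySmooth.const_mul (hf : IsEssentiallySmooth f) (hε : 0 < ε) :
    IsEssentiallySmooth fun x => (ε : EReal) * f x where
  interior_nonempty := by
    rw [effDom_const_mul hε]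
    exact hf.interior_nonempty
  differentiableAt x hx := by
    rw [effDom_const_mul hε] at hx
    rw [toReal_const_mul]
    exact (hf.differentiableAt x hx).const_smul ε
  steep u b hu hb hlim := by
    rw [effDom_const_mul hε] at hu hb
    simpa only [grad_const_mul, norm_smul, Real.norm_of_nonneg hε.le] using
      (hf.steep u b hu hb hlim).const_mul_atTop hε

theorem IsEssentiallyStrictlyConvex.const_mul (hf : IsEssentiallyStrictlyConvex f) (hε : 0 < ε) :
    IsEssentiallyStrictlyConvex fun x => (ε : EReal) * f x := by
  intro S hS hconv
  rw [domSubdiff_const_mul hε] at hS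
  rw [toReal_const_mul]
  refine ⟨hconv, fun x hx y hy hne a b ha hb hab => ?_⟩
  have hlt := mul_lt_mul_of_pos_left ((hf S hS hconv).2 hx hy hne ha hb hab) hε
  simp only [Pi.smul_apply, smul_eq_mul] at hlt ⊢
  linarith

theorem IsLegendre.const_mul (hf : IsLegendre f) (hε : 0 < ε) :
    IsLegendre fun x => (ε : EReal) * f x where
  isClosedFun := hf.isClosedFun.const_mul hε
  isProperFun := hf.isProperFun.const_mul hε
  isConvexFun := hf.isConvexFun.const_mul hε
  essentiallySmooth := hf.essentiallySmooth.const_mul hε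
  essentiallyStrictlyConvex := hf.essentiallyStrictlyConvex.const_mul hε

end Scaling

end ConvexDuality

theorem mainTheorem5 {n : ℕ} (ϑ ψ : EuclideanSpace ℝ (Fin n) → EReal) (ε : ℝ) (hε : 0 < ε)
    (hϑ : IsLegendre ϑ) (hψ : ∀ x, ψ x = (ε : EReal) * ϑ x) :
    -- (i)
    (IsClosedFun (conjugate ψ) ∧ IsProperFun (conjugate ψ) ∧ IsLegendre (conjugate ψ) ∧
      ((IsSupercoercive ϑ ∨ ∀ z, (mirrorArgmax ψ z).Nonempty) →
        effDom (conjugate ψ) = Set.univ)) ∧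
    -- (ii)
    (∃ e : interior (effDom ψ) ≃ₜ interior (effDom (conjugate ψ)),
      (∀ x : interior (effDom ψ),
        (e x : EuclideanSpace ℝ (Fin n)) = grad ψ (x : EuclideanSpace ℝ (Fin n))) ∧
      (∀ z : interior (effDom (conjugate ψ)),
        (e.symm z : EuclideanSpace ℝ (Fin n)) =
          grad (conjugate ψ) (z : EuclideanSpace ℝ (Fin n)))) ∧
    (∀ z ∈ interior (effDom (conjugate ψ)),
      mirrorArgmax ψ z = {mirrorMap ψ z} ∧ grad (conjugate ψ) z = mirrorMap ψ z) ∧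
    -- (iii)
    StrictlyMonotoneOn (mirrorMap ψ) (interior (effDom (conjugate ψ))) := by
  obtain rfl : ψ = fun x => (ε : EReal) * ϑ x := funext hψ
  have hL := hϑ.const_mul hε
  refine ⟨⟨isClosedFun_conjugate, hL.isProperFun_conjugate, hL.isLegendre_conjugate, fun h => ?_⟩,
    ⟨hL.gradHomeomorph, fun _ => rfl, fun _ => rfl⟩, fun z hz => ?_,
    hL.strictlyMonotoneOn_mirrorMap⟩
  · refine hL.isProperFun.effDom_conjugate_eq_univ fun z => ?_
    rcases h with hs | hmax
    · exact (hs.const_mul hε).mirrorArgmax_nonempty hL.isClosedFun hL.isProperFun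
    · exact hmax z
  · rw [hL.mirrorMap_eq hz]
    exact ⟨hL.mirrorArgmax_eq hz, rfl⟩
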